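/- For a point set $V_1,\dots,V_n$ in the plane, the unit disk graph has vertices $1,\dots,n$, with $i\ne j$ adjacent iff $|V_i-V_j|<1$; let $N(i)$ consist of $i$ and its neighbours. Rule 2 prunes the vertex $i$ iff $N(i)$ contains two vertices $i_1>i_2>i$ that are adjacent to each other and satisfy $N(i)\subseteq N(i_1)\cup N(i_2)$. The vertices that are not pruned form the Rule 2 dominating set. Let $(\ell_n)$ be a real sequence for which there is a constant $\bar c>0$ such that $\log n\le \ell_n\le \bar c\sqrt{n/\log n}$ for all $n>1$. Let $V_1,\dots,V_n$ be independent and uniformly distributed in an $\ell_n\times\ell_n$ square; let $U_n$ be the number of vertices that Rule 2 prunes in their unit disk graph, and let $C_n$ be the size of the Rule 2 dominating set. (a) Let $(\alpha_n)$ be any real sequence and $\xi_n=\alpha_n/\ell_n^2$, and suppose that $\alpha_n=o(n)$, that $\xi_n\to\infty$, and that $\alpha_n>16n/(\log\xi_n)^{3/2}$ for all sufficiently large $n$. Then $E(U_n)\ge n-O(\alpha_n)$; that is, there is a constant $C>0$ such that $E(U_n)\ge n-C\alpha_n$ for all sufficiently large $n$. Consequently $E(C_n)=O(\alpha_n)$.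 (b) $E(C_n)=O\bigl(n/(\log\log n)^{3/2}\bigr)$. In particular this holds when $\ell_n=\Theta(\sqrt{n/\log n})$. -/

import Mathlib

open MeasureTheory ProbabilityTheory Filter Asymptotics

noncomputable section

/-- The Euclidean plane. -/
abbrev Plane : Type := EuclideanSpace ℝ (Fin 2)

/-- The closed neighbourhood of `v`: the vertex `v` together with all vertices adjacent to it. -/
def closedNbhd {V : Type*} (G : SimpleGraph V) (v : V) : Set V :=
  insert v (G.neighborSet v)

/-- Rule 2 excludes the vertex `v`: the closed neighbourhood of `v` contains two adjacent vertices
`a > b > v` whose closed neighbourhoods together cover the closed neighbourhood of `v`.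
The order on `V` is the order of the vertex identifiers. -/
def Rule2Excludes {V : Type*} [LinearOrder V] (G : SimpleGraph V) (v : V) : Prop :=
  ∃ a b : V, a ∈ closedNbhd G v ∧ b ∈ closedNbhd G v ∧ v < b ∧ b < a ∧
    closedNbhd G v ⊆ closedNbhd G a ∪ closedNbhd G b ∧ G.Adj a b

open Classical in
/-- The vertices that Rule 2 prunes (the non-gateway nodes). -/
def rule2Pruned {V : Type*} [Fintype V] [LinearOrder V] (G : SimpleGraph V) : Finset V :=
  Finset.univ.filter fun v => Rule2Excludes G v

open Classical in
/-- The Rule 2 dominating set: the vertices that are not pruned (the gateway nodes). -/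
def rule2Set {V : Type*} [Fintype V] [LinearOrder V] (G : SimpleGraph V) : Finset V :=
  Finset.univ.filter fun v => ¬ Rule2Excludes G v

/-- The unit disk graph of the points `x 0, …, x (n - 1)`: two vertices are adjacent iff their
Euclidean distance is less than one. -/
def unitDiskGraph {n : ℕ} (x : Fin n → Plane) : SimpleGraph (Fin n) where
  Adj i j := i ≠ j ∧ dist (x i) (x j) < 1
  symm := ⟨fun _ _ h => ⟨h.1.symm, by rw [dist_comm]; exact h.2⟩⟩
  loopless := ⟨fun _ h => h.1 rfl⟩

/-- The square `[0, s] × [0, s]`. -/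
def square (s : ℝ) : Set Plane := {p | ∀ i, p i ∈ Set.Icc (0 : ℝ) s}

/-- The law of `n` independent points, each uniformly distributed on `[0, s] × [0, s]`. -/
def uniformPoints (n : ℕ) (s : ℝ) : Measure (Fin n → Plane) :=
  Measure.pi fun _ => cond (volume : Measure Plane) (square s)

/-- The expected number of vertices pruned by Rule 2 on the random unit disk graph of `n`
independent uniform points of `[0, s] × [0, s]`. -/
def expectedPruned (n : ℕ) (s : ℝ) : ℝ :=
  ∫ x, ((rule2Pruned (unitDiskGraph x)).card : ℝ) ∂(uniformPoints n s)

/-- The expected size of the Rule 2 dominating set of the random unit disk graph of `n`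
independent uniform points of `[0, s] × [0, s]`. -/
def expectedRule2Size (n : ℕ) (s : ℝ) : ℝ :=
  ∫ x, ((rule2Set (unitDiskGraph x)).card : ℝ) ∂(uniformPoints n s)

end

/-!
A vertex that is not among the last identifiers is pruned with high probability, by a pair of
partners on opposite sides of it at very different scales. Put `a = α n`, `s = ℓ n`,
`ξ = a / s ^ 2` and `t = ξ ^ (1 / 60)`, let `m` be `a` rounded up, and reserve the last `m`
identifiers and the `m` identifiers before them for the two partners. For a vertex at `p`, the near
partner is sought in the disk of radius `r = t ^ (-29)` about `p`. Once it is found, the far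
partner is sought in a rectangle of size `R / 2` by `2 * R ^ 2` on the ray from `p` away from the
near partner, where `R = t ^ (-19)`. The two numbers of candidates have expectations of order
`ξ * r ^ 2 = t ^ 2` and `ξ * R ^ 3 = t ^ 3`, so both searches fail only with exponentially small
probability. The part of the unit disk about `p` that neither partner covers has area at most
`144 * R ^ 2 * r` (`volume_gap_le`): it is confined to the unit annulus of thickness `O (r * R)`
and to a strip of width `O (R)` orthogonal to the direction of the partners. Hence the expected
number of triples formed by two partners and a point in their gap is of order
`t ^ 2 * t ^ 3 * (n / s ^ 2) * R ^ 2 * r = (n / a) * t ^ (-2)`.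

The hypothesis on `α` enters only through `n / a ≤ t`, which makes this expectation at most of order
`1 / t ≤ a / n`. Vertices at distance less than `2 * R` from the border, where the far partner may
fall outside the square, have probability `O (R / s)`, which is `O (1 / t)` as well. Summing over
the vertices yields `O (a)` (`expectedRule2Size_le_of_density`). Only first moments are used, and
every probability is found by exposing one coordinate of the product measure at a time
(`pi_real_inter_le`). The last assertion is the case `α n = 100 * n / (log log n) ^ (3 / 2)`.
-/

/-! ### Adapted coordinates in the plane -/

theorem Plane.dist_sq (x y : Plane) : dist x y ^ 2 = (x 0 - y 0) ^ 2 + (x 1 - y 1) ^ 2 := by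
  rw [EuclideanSpace.dist_eq, Real.sq_sqrt (by positivity), Fin.sum_univ_two]
  simp [Real.dist_eq, sq_abs]

/-- The Cartesian coordinates of `q` in the orthonormal frame with origin `p` whose first axis
points from `p` towards `a`. Both coordinates are `0` in the degenerate case `a = p`. -/
noncomputable def frame (p a q : Plane) : ℝ × ℝ :=
  (((a 0 - p 0) * (q 0 - p 0) + (a 1 - p 1) * (q 1 - p 1)) / dist a p,
    ((a 0 - p 0) * (q 1 - p 1) - (a 1 - p 1) * (q 0 - p 0)) / dist a p)

theorem frame_self_left (p a : Plane) : frame p a p = 0 := by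
  simp [frame]

theorem frame_self_right {p a : Plane} (h : 0 < dist a p) : frame p a a = (dist a p, 0) := by
  have := Plane.dist_sq a p
  ext
  · simp only [frame]
    rw [div_eq_iff h.ne']
    linarith
  · simp only [frame]
    rw [div_eq_iff h.ne']
    ring

theorem dist_sq_eq_frame {p a : Plane} (h : 0 < dist a p) (q q' : Plane) :
    dist q q' ^ 2 = ((frame p a q).1 - (frame p a q').1) ^ 2
      + ((frame p a q).2 - (frame p a q').2) ^ 2 := by
  have h1 := Plane.dist_sq a p
  have h2 := Plane.dist_sq q q'
  simp only [frame]
  rw [← sub_div, ← sub_div, div_pow, div_pow, ← add_div, eq_div_iff (by positivity), h1, h2]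
  ring

theorem dist_sq_origin_eq_frame {p a : Plane} (h : 0 < dist a p) (q : Plane) :
    dist q p ^ 2 = (frame p a q).1 ^ 2 + (frame p a q).2 ^ 2 := by
  rw [dist_sq_eq_frame h, frame_self_left]
  simp

theorem dist_sq_axis_eq_frame {p a : Plane} (h : 0 < dist a p) (q : Plane) :
    dist q a ^ 2 = ((frame p a q).1 - dist a p) ^ 2 + (frame p a q).2 ^ 2 := by
  rw [dist_sq_eq_frame h, frame_self_right h]
  simp

theorem measurable_plane_coord {X : Type*} [MeasurableSpace X] {f : X → Plane}
    (hf : Measurable f) (i : Fin 2) : Measurable fun x => f x i :=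
  (show Continuous fun q : Plane => q i by fun_prop).measurable.comp hf

@[fun_prop]
theorem Measurable.frame {X : Type*} [MeasurableSpace X] {f g h : X → Plane}
    (hf : Measurable f) (hg : Measurable g) (hh : Measurable h) :
    Measurable fun x => frame (f x) (g x) (h x) := by
  have := measurable_plane_coord hf
  have := measurable_plane_coord hg
  have := measurable_plane_coord hh
  unfold _root_.frame
  fun_prop

/-- The frame coordinates preserve the area, being a translation followed by an isometry. -/
theorem measurePreserving_frame {p a : Plane} (h : 0 < dist a p) :
    MeasurePreserving (frame p a) := by
  have hd := Plane.dist_sq a p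
  let v : Fin 2 → Plane :=
    ![!₂[(a 0 - p 0) / dist a p, (a 1 - p 1) / dist a p],
      !₂[-(a 1 - p 1) / dist a p, (a 0 - p 0) / dist a p]]
  have hv : Orthonormal ℝ v := by
    rw [orthonormal_iff_ite]
    intro i j
    fin_cases i <;> fin_cases j <;>
      simp only [v, PiLp.inner_apply, Fin.sum_univ_two] <;> simp <;> field_simp <;>
      (try simp only [sq_abs]) <;> linarith
  let b := (basisOfOrthonormalOfCardEqFinrank hv (by simp)).toOrthonormalBasis
    (by simpa using hv)
  have hb : ⇑b = v := by simp [b]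
  have key : frame p a = (MeasurableEquiv.finTwoArrow (α := ℝ)) ∘
      (WithLp.ofLp ∘ b.repr ∘ fun q => q - p) := by
    funext q
    ext
    · simp [frame, MeasurableEquiv.finTwoArrow, b.repr_apply_apply, hb, v, PiLp.inner_apply,
        Fin.sum_univ_two]
      ring
    · simp [frame, MeasurableEquiv.finTwoArrow, b.repr_apply_apply, hb, v, PiLp.inner_apply,
        Fin.sum_univ_two]
      ring
  rw [key]
  exact (volume_preserving_finTwoArrow ℝ).comp ((PiLp.volume_preserving_ofLp (Fin 2)).comp
    (b.measurePreserving_repr.comp (measurePreserving_sub_right volume p)))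

/-! ### The three regions attached to a vertex and two candidates -/

/-- The punctured closed disk of radius `r` about `p`. -/
def nearDisk (r : ℝ) (p : Plane) : Set Plane := {a | 0 < dist a p ∧ dist a p ≤ r}

/-- A rectangle of size `R / 2` by `2 * R ^ 2` at distance `R / 2` from `p`, centred on the ray
from `p` away from `a`. -/
def oppositeBox (R : ℝ) (p a : Plane) : Set Plane :=
  frame p a ⁻¹' (Set.Icc (-R) (-(R / 2)) ×ˢ Set.Icc (-R ^ 2) (R ^ 2))

/-- The part of the open unit disk about `p` that is not covered by those about `a` and `b`. -/
def gap (p a b : Plane) : Set Plane := {q | dist q p < 1 ∧ 1 ≤ dist q a ∧ 1 ≤ dist q b}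

theorem volume_nearDisk (r : ℝ) (hr : 0 ≤ r) (p : Plane) :
    volume (nearDisk r p) = ENNReal.ofReal (Real.pi * r ^ 2) := by
  have : nearDisk r p = Metric.closedBall p r \ {p} := by
    ext q
    simp [nearDisk, and_comm]
  rw [this, measure_sdiff_null (by simp), EuclideanSpace.volume_closedBall_fin_two,
    mul_comm, ENNReal.ofReal_mul Real.pi_pos.le, ENNReal.ofReal_pow hr]

theorem volume_oppositeBox {R : ℝ} (hR : 0 ≤ R) {p a : Plane} (h : 0 < dist a p) :
    volume (oppositeBox R p a) = ENNReal.ofReal (R ^ 3) := by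
  rw [oppositeBox, (measurePreserving_frame h).measure_preimage
    (measurableSet_Icc.prod measurableSet_Icc).nullMeasurableSet, Measure.volume_eq_prod,
    Measure.prod_prod, Real.volume_Icc, Real.volume_Icc, ← ENNReal.ofReal_mul (by linarith)]
  congr 1
  ring

theorem dist_lt_one_of_mem {r R : ℝ} (hrR : r ≤ R) (hR : R ≤ 1 / 10) {p a b : Plane}
    (ha : a ∈ nearDisk r p) (hb : b ∈ oppositeBox R p a) :
    dist b p ≤ 2 * R ∧ dist a b < 1 := by
  obtain ⟨h0, h1⟩ := ha
  simp only [oppositeBox, Set.mem_preimage, Set.mem_prod, Set.mem_Icc] at hb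
  obtain ⟨⟨hb1, hb2⟩, hb3, hb4⟩ := hb
  have hb' := dist_sq_origin_eq_frame h0 b
  have hbp : dist b p ≤ 2 * R := by
    refine (sq_le_sq₀ dist_nonneg (by linarith)).1 ?_
    rw [hb']
    have hR2 : R ^ 2 ≤ R := by nlinarith
    nlinarith
  refine ⟨hbp, ?_⟩
  have := dist_triangle a p b
  rw [dist_comm p b] at this
  linarith

/-- In frame coordinates the gap lies in a thin piece of the unit annulus: within the unit disk, `a`
covers everything beyond the bisector of `p` and `a`, and `b` everything left of `-4 * R`. -/
theorem gap_subset {r R : ℝ} (hrR : r ≤ R) (hR : R ≤ 1 / 10) {p a b : Plane}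
    (ha : a ∈ nearDisk r p) (hb : b ∈ oppositeBox R p a) :
    gap p a b ⊆ frame p a ⁻¹' {z | z.1 ∈ Set.Icc (-(4 * R)) (4 * R) ∧
      1 - z.1 ^ 2 - 9 * r * R ≤ z.2 ^ 2 ∧ z.2 ^ 2 ≤ 1 - z.1 ^ 2} := by
  rintro q ⟨hqp, hqa, hqb⟩
  obtain ⟨h0, h1⟩ := ha
  simp only [oppositeBox, Set.mem_preimage, Set.mem_prod, Set.mem_Icc] at hb
  obtain ⟨⟨hb1, hb2⟩, hb3, hb4⟩ := hb
  have e1 := dist_sq_origin_eq_frame h0 q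
  have e2 := dist_sq_axis_eq_frame h0 q
  have e3 := dist_sq_eq_frame h0 q b
  have f1 : dist q p ^ 2 < 1 := pow_lt_one₀ dist_nonneg hqp two_ne_zero
  have f2 : 1 ≤ dist q a ^ 2 := one_le_pow₀ hqa
  have f3 : 1 ≤ dist q b ^ 2 := one_le_pow₀ hqb
  rw [e1] at f1
  rw [e2] at f2
  rw [e3] at f3
  simp only [Set.mem_preimage, Set.mem_ofPred_eq, Set.mem_Icc]
  generalize (frame p a q).1 = X at *
  generalize (frame p a q).2 = Y at *
  generalize (frame p a b).1 = S at *
  generalize (frame p a b).2 = T at *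
  generalize dist a p = ρ at *
  clear e1 e2 e3 hqp hqa hqb
  have hX : X < ρ / 2 := by
    by_contra hX
    have := mul_le_mul_of_nonneg_left (not_lt.1 hX) h0.le
    linarith
  have hY : |Y * T| ≤ R ^ 2 := by
    rw [abs_mul]
    have hY1 : |Y| ≤ 1 := abs_le_one_iff_mul_self_le_one.2 (by nlinarith)
    have hT1 : |T| ≤ R ^ 2 := abs_le.2 ⟨by linarith, hb4⟩
    calc |Y| * |T| ≤ 1 * R ^ 2 := mul_le_mul hY1 hT1 (abs_nonneg T) zero_le_one
      _ = R ^ 2 := one_mul _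
  have hR2 : R ^ 2 * R ^ 2 ≤ R ^ 2 * 1 :=
    mul_le_mul_of_nonneg_left (by nlinarith) (sq_nonneg R)
  have hT : T ^ 2 ≤ (R ^ 2) ^ 2 := sq_le_sq' (by linarith) hb4
  have hS : S ^ 2 ≤ R ^ 2 := sq_le_sq.2 (abs_le_abs_of_nonpos (by linarith) hb1 |>.trans_eq
    (abs_neg R))
  have hX2 : -(4 * R) ≤ X := by
    by_contra hX2
    have : 4 * R * (R / 2) ≤ -X * -S :=
      mul_le_mul (by linarith) (by linarith) (by linarith) (by linarith)
    linarith [neg_abs_le (Y * T), le_abs_self (Y * T)]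
  refine ⟨⟨hX2, by linarith⟩, ?_, by linarith⟩
  have : ρ * (ρ - 2 * X) ≤ r * (9 * R) := by
    apply mul_le_mul h1 (by linarith) (by linarith) (by linarith)
  linarith

/-- A shell in the line of thickness `h` in the squared coordinate has length at most `2 * h`. -/
theorem volume_sq_shell_le (s h : ℝ) (hh : 0 ≤ h) (hs : 1 / 4 ≤ s - h) :
    volume {y : ℝ | s - h ≤ y ^ 2 ∧ y ^ 2 ≤ s} ≤ ENNReal.ofReal (2 * h) := by
  have hlen : √s - √(s - h) ≤ h := by
    have h1 : 1 / 2 ≤ √(s - h) := Real.le_sqrt_of_sq_le (by linarith)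
    have h2 : √(s - h) ≤ √s := Real.sqrt_le_sqrt (by linarith)
    have h3 := Real.sq_sqrt (show 0 ≤ s - h by linarith)
    have h4 := Real.sq_sqrt (show 0 ≤ s by linarith)
    nlinarith
  have hsub : {y : ℝ | s - h ≤ y ^ 2 ∧ y ^ 2 ≤ s} ⊆
      Set.Icc (√(s - h)) (√s) ∪ Set.Icc (-√s) (-√(s - h)) := by
    rintro y ⟨h1, h2⟩
    have h3 := Real.sqrt_le_sqrt h1
    have h4 := Real.sqrt_le_sqrt h2
    rw [Real.sqrt_sq_eq_abs] at h3 h4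
    rcases abs_cases y with ⟨h5, -⟩ | ⟨h5, -⟩
    · exact Or.inl ⟨by linarith, by linarith⟩
    · exact Or.inr ⟨by linarith, by linarith⟩
  refine (measure_mono hsub).trans ((measure_union_le _ _).trans ?_)
  rw [Real.volume_Icc, Real.volume_Icc, two_mul, ENNReal.ofReal_add hh hh]
  exact add_le_add (ENNReal.ofReal_le_ofReal hlen) (ENNReal.ofReal_le_ofReal (by linarith))

theorem volume_gap_le {r R : ℝ} (hrR : r ≤ R) (hR : R ≤ 1 / 10) {p a b : Plane}
    (ha : a ∈ nearDisk r p) (hb : b ∈ oppositeBox R p a) :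
    volume (gap p a b) ≤ ENNReal.ofReal (144 * R ^ 2 * r) := by
  have hr : 0 < r := ha.1.trans_le ha.2
  have hmeas : MeasurableSet {z : ℝ × ℝ | z.1 ∈ Set.Icc (-(4 * R)) (4 * R) ∧
      1 - z.1 ^ 2 - 9 * r * R ≤ z.2 ^ 2 ∧ z.2 ^ 2 ≤ 1 - z.1 ^ 2} := by
    exact (measurableSet_Icc.preimage measurable_fst).inter
      ((measurableSet_le (f := fun z : ℝ × ℝ => 1 - z.1 ^ 2 - 9 * r * R)
          (g := fun z => z.2 ^ 2) (by fun_prop) (by fun_prop)).inter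
        (measurableSet_le (f := fun z : ℝ × ℝ => z.2 ^ 2)
          (g := fun z => 1 - z.1 ^ 2) (by fun_prop) (by fun_prop)))
  refine (measure_mono (gap_subset hrR hR ha hb)).trans ?_
  rw [(measurePreserving_frame ha.1).measure_preimage hmeas.nullMeasurableSet,
    Measure.volume_eq_prod, Measure.prod_apply hmeas]
  calc _ ≤ ∫⁻ x, (Set.Icc (-(4 * R)) (4 * R)).indicator
        (fun _ => ENNReal.ofReal (2 * (9 * r * R))) x := by
        apply lintegral_mono
        intro x
        by_cases hx : x ∈ Set.Icc (-(4 * R)) (4 * R)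
        · rw [Set.indicator_of_mem hx]
          refine (measure_mono fun y hy => hy.2).trans (volume_sq_shell_le (1 - x ^ 2) (9 * r * R)
            (mul_nonneg (by linarith) (by linarith)) ?_)
          obtain ⟨hx1, hx2⟩ := hx
          nlinarith
        · rw [Set.indicator_of_notMem hx]
          refine (measure_mono_null (fun y hy => hx hy.1) measure_empty).le
    _ = ENNReal.ofReal (144 * R ^ 2 * r) := by
        rw [lintegral_indicator measurableSet_Icc, setLIntegral_const, Real.volume_Icc,
          ← ENNReal.ofReal_mul (by nlinarith)]
        congr 1
        ring

/-! ### A deterministic criterion for pruning -/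

theorem mem_closedNbhd_unitDiskGraph {n : ℕ} (x : Fin n → Plane) (i j : Fin n) :
    j ∈ closedNbhd (unitDiskGraph x) i ↔ dist (x j) (x i) < 1 := by
  by_cases h : j = i
  · simp [closedNbhd, h]
  · simp [closedNbhd, unitDiskGraph, h, Ne.symm h, dist_comm]

theorem rule2Excludes_of_gap_empty {n : ℕ} {x : Fin n → Plane} {i a b : Fin n} {r R : ℝ}
    (hrR : r ≤ R) (hR : R ≤ 1 / 10) (hia : i < a) (hab : a < b)
    (ha : x a ∈ nearDisk r (x i)) (hb : x b ∈ oppositeBox R (x i) (x a))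
    (hgap : ∀ j, j ≠ i → j ≠ a → j ≠ b → x j ∉ gap (x i) (x a) (x b)) :
    Rule2Excludes (unitDiskGraph x) i := by
  obtain ⟨h1, h2⟩ := dist_lt_one_of_mem hrR hR ha hb
  have h3 : dist (x a) (x i) < 1 := ha.2.trans_lt (by linarith)
  refine ⟨b, a, ?_, ?_, hia, hab, ?_, hab.ne', by rwa [dist_comm]⟩
  · rw [mem_closedNbhd_unitDiskGraph]
    linarith
  · rwa [mem_closedNbhd_unitDiskGraph]
  · intro j hj
    rw [Set.mem_union, mem_closedNbhd_unitDiskGraph, mem_closedNbhd_unitDiskGraph]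
    rw [mem_closedNbhd_unitDiskGraph] at hj
    by_contra! hcon
    refine hgap j ?_ ?_ ?_ ⟨hj, hcon.2, hcon.1⟩
    · rintro rfl
      rw [dist_comm] at h3
      exact h3.not_ge hcon.2
    · rintro rfl
      exact absurd hcon.2 (by simp)
    · rintro rfl
      exact absurd hcon.1 (by simp)

/-! ### Exposing one coordinate of a product measure at a time -/

section Product

variable {ι X : Type*} [Fintype ι] [DecidableEq ι] [MeasurableSpace X]

/-- If `E` does not depend on the coordinate `j`, and, once the other coordinates are fixed inside
`E`, the event `F` has probability at most `c` in the coordinate `j`, then conditioning on `E`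
leaves `F` with probability at most `c`. -/
theorem pi_real_inter_le (ν : Measure X) [IsProbabilityMeasure ν] (j : ι) {E F : Set (ι → X)}
    (hE : MeasurableSet E) (hF : MeasurableSet F)
    (hinv : ∀ x y, Function.update x j y ∈ E ↔ x ∈ E) {c : ℝ} (hc : 0 ≤ c)
    (h : ∀ x ∈ E, ν.real {y | Function.update x j y ∈ F} ≤ c) :
    (Measure.pi fun _ : ι => ν).real (E ∩ F) ≤ c * (Measure.pi fun _ : ι => ν).real E := by
  have key : (Measure.pi fun _ : ι => ν) (E ∩ F) ≤
      ENNReal.ofReal c * (Measure.pi fun _ : ι => ν) E := by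
    rw [← lintegral_indicator_one (hE.inter hF), ← lintegral_indicator_one hE,
      ← lintegral_const_mul _ (measurable_one.indicator hE)]
    refine lintegral_le_of_lmarginal_le {j} (measurable_one.indicator (hE.inter hF))
      ((measurable_one.indicator hE).const_mul _) ?_
    rw [lmarginal_singleton, lmarginal_singleton]
    intro x
    by_cases hx : x ∈ E
    · have h1 : ∀ y, (E ∩ F).indicator (1 : (ι → X) → ENNReal) (Function.update x j y) =
          {y | Function.update x j y ∈ F}.indicator 1 y := by
        intro y
        by_cases hy : Function.update x j y ∈ F
        · exact (Set.indicator_of_mem (Set.mem_inter ((hinv x y).2 hx) hy) _).trans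
            (Set.indicator_of_mem (s := {y | Function.update x j y ∈ F}) hy 1).symm
        · exact (Set.indicator_of_notMem (fun hm : _ ∈ E ∩ F => hy hm.2) _).trans
            (Set.indicator_of_notMem (s := {y | Function.update x j y ∈ F}) hy _).symm
      have h2 : ∀ y, E.indicator (1 : (ι → X) → ENNReal) (Function.update x j y) = 1 := by
        intro y
        simp [Set.indicator, hinv, hx]
      simp only [h1, h2]
      rw [lintegral_indicator_one (show MeasurableSet {y | Function.update x j y ∈ F} from
        measurable_update x hF)]
      simp only [mul_one, lintegral_const, measure_univ]
      exact ENNReal.le_ofReal_iff_toReal_le (measure_ne_top _ _) hc |>.2 (h x hx)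
    · have h1 : ∀ y, (E ∩ F).indicator (1 : (ι → X) → ENNReal) (Function.update x j y) = 0 := by
        intro y
        simp [Set.indicator, Set.mem_inter_iff, hinv, hx]
      simp only [h1]
      simp
  have := ENNReal.toReal_mono (ENNReal.mul_ne_top ENNReal.ofReal_ne_top (measure_ne_top _ _)) key
  rwa [ENNReal.toReal_mul, ENNReal.toReal_ofReal hc] at this

/-- The version of `pi_real_inter_le` for several coordinates, each with its own event. -/
theorem pi_real_inter_forall_le (ν : Measure X) [IsProbabilityMeasure ν] (S : Finset ι)
    {E : Set (ι → X)} {F : ι → Set (ι → X)} (hE : MeasurableSet E)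
    (hF : ∀ b ∈ S, MeasurableSet (F b))
    (hEinv : ∀ b ∈ S, ∀ x y, Function.update x b y ∈ E ↔ x ∈ E)
    (hFinv : ∀ b ∈ S, ∀ b' ∈ S, b ≠ b' → ∀ x y, Function.update x b' y ∈ F b ↔ x ∈ F b)
    {c : ℝ} (hc : 0 ≤ c)
    (h : ∀ b ∈ S, ∀ x ∈ E, ν.real {y | Function.update x b y ∈ F b} ≤ c) :
    (Measure.pi fun _ : ι => ν).real (E ∩ {x | ∀ b ∈ S, x ∈ F b}) ≤
      c ^ S.card * (Measure.pi fun _ : ι => ν).real E := by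
  induction S using Finset.induction_on with
  | empty => simp
  | insert b S hb ih =>
    have hset : E ∩ {x | ∀ b' ∈ insert b S, x ∈ F b'} =
        (E ∩ {x | ∀ b' ∈ S, x ∈ F b'}) ∩ F b := by
      ext x
      simp only [Set.mem_inter_iff, Set.mem_ofPred_eq, Finset.mem_insert, forall_eq_or_imp]
      tauto
    have hmeas : MeasurableSet {x | ∀ b' ∈ S, x ∈ F b'} := by
      have : {x | ∀ b' ∈ S, x ∈ F b'} = ⋂ b' ∈ S, F b' := by
        ext x
        simp
      rw [this]
      exact Finset.measurableSet_biInter _ fun b' hb' => hF b' (Finset.mem_insert_of_mem hb')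
    have ih' := ih (fun b' hb' => hF b' (Finset.mem_insert_of_mem hb'))
      (fun b' hb' => hEinv b' (Finset.mem_insert_of_mem hb'))
      (fun b₁ h₁ b₂ h₂ => hFinv b₁ (Finset.mem_insert_of_mem h₁) b₂ (Finset.mem_insert_of_mem h₂))
      (fun b' hb' => h b' (Finset.mem_insert_of_mem hb'))
    rw [hset, Finset.card_insert_of_notMem hb, pow_succ', mul_assoc]
    refine (pi_real_inter_le ν b (hE.inter hmeas) (hF b (Finset.mem_insert_self b S)) ?_ hc
      fun x hx => h b (Finset.mem_insert_self b S) x hx.1).trans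
      (mul_le_mul_of_nonneg_left ih' hc)
    intro x y
    simp only [Set.mem_inter_iff, Set.mem_ofPred_eq]
    rw [hEinv b (Finset.mem_insert_self b S)]
    refine and_congr_right fun _ => forall₂_congr fun b' hb' => ?_
    refine hFinv b' (Finset.mem_insert_of_mem hb') b (Finset.mem_insert_self b S) ?_ x y
    rintro rfl
    exact hb hb'

end Product

/-! ### The uniform distribution on the square -/

theorem volume_plane_box (u v : ℝ) (huv : u ≤ v) :
    volume {p : Plane | ∀ i, p i ∈ Set.Icc u v} = ENNReal.ofReal ((v - u) ^ 2) := by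
  have : {p : Plane | ∀ i, p i ∈ Set.Icc u v} =
      WithLp.ofLp ⁻¹' (Set.Icc (fun _ : Fin 2 => u) (fun _ => v)) := by
    ext p
    simp [Pi.le_def, forall_and]
  rw [this, (PiLp.volume_preserving_ofLp (Fin 2)).measure_preimage
    measurableSet_Icc.nullMeasurableSet, Real.volume_Icc_pi]
  simp [ENNReal.ofReal_pow (sub_nonneg.2 huv)]

theorem measurableSet_plane_box (u v : ℝ) : MeasurableSet {p : Plane | ∀ i, p i ∈ Set.Icc u v} := by
  have : {p : Plane | ∀ i, p i ∈ Set.Icc u v} =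
      ⋂ i : Fin 2, (fun p : Plane => p i) ⁻¹' (Set.Icc u v) := by
    ext p
    simp
  rw [this]
  exact MeasurableSet.iInter fun i => measurable_plane_coord measurable_id i measurableSet_Icc

theorem volume_square {s : ℝ} (hs : 0 ≤ s) : volume (square s) = ENNReal.ofReal (s ^ 2) := by
  rw [square, volume_plane_box 0 s hs, sub_zero]

theorem measurableSet_square (s : ℝ) : MeasurableSet (square s) :=
  measurableSet_plane_box 0 s

theorem isProbabilityMeasure_cond_square {s : ℝ} (hs : 0 < s) :
    IsProbabilityMeasure (cond (volume : Measure Plane) (square s)) := by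
  apply cond_isProbabilityMeasure_of_finite
  · rw [volume_square hs.le]
    simpa using hs.ne'
  · rw [volume_square hs.le]
    simp

theorem isProbabilityMeasure_uniformPoints (n : ℕ) {s : ℝ} (hs : 0 < s) :
    IsProbabilityMeasure (uniformPoints n s) := by
  have := isProbabilityMeasure_cond_square hs
  unfold uniformPoints
  infer_instance

theorem cond_square_real_eq {s v : ℝ} (hs : 0 < s) (hv : 0 ≤ v) {T : Set Plane}
    (hT : T ⊆ square s) (h : volume T = ENNReal.ofReal v) :
    (cond (volume : Measure Plane) (square s)).real T = v / s ^ 2 := by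
  rw [measureReal_def, cond_apply (measurableSet_square s), Set.inter_eq_right.2 hT, h,
    volume_square hs.le, ENNReal.toReal_mul, ENNReal.toReal_inv, ENNReal.toReal_ofReal hv,
    ENNReal.toReal_ofReal (by positivity)]
  ring

theorem cond_square_real_le {s v : ℝ} (hs : 0 < s) (hv : 0 ≤ v) {T : Set Plane}
    (h : volume T ≤ ENNReal.ofReal v) :
    (cond (volume : Measure Plane) (square s)).real T ≤ v / s ^ 2 := by
  have h1 : (cond (volume : Measure Plane) (square s)) T ≤
      (ENNReal.ofReal (s ^ 2))⁻¹ * ENNReal.ofReal v := by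
    rw [cond_apply (measurableSet_square s), volume_square hs.le]
    gcongr
    exact (measure_mono Set.inter_subset_right).trans h
  have h2 := ENNReal.toReal_mono (ENNReal.mul_ne_top (by simpa using hs.ne') (by simp)) h1
  rw [ENNReal.toReal_mul, ENNReal.toReal_inv, ENNReal.toReal_ofReal hv,
    ENNReal.toReal_ofReal (by positivity)] at h2
  rw [measureReal_def, div_eq_inv_mul]
  exact h2

/-- The points of `[0, s] × [0, s]` at distance at least `d` from the border. -/
def innerSquare (d s : ℝ) : Set Plane := {p | ∀ i, p i ∈ Set.Icc d (s - d)}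

theorem measurableSet_innerSquare (d s : ℝ) : MeasurableSet (innerSquare d s) :=
  measurableSet_plane_box d (s - d)

theorem mem_square_of_mem_innerSquare {d s : ℝ} {p q : Plane} (hp : p ∈ innerSquare d s)
    (hq : dist q p ≤ d) : q ∈ square s := by
  have h := Plane.dist_sq q p
  have h2 : dist q p ^ 2 ≤ d ^ 2 := pow_le_pow_left₀ dist_nonneg hq 2
  have hd : 0 ≤ d := dist_nonneg.trans hq
  have key : ∀ i, |q i - p i| ≤ d := by
    intro i
    apply abs_le_of_sq_le_sq _ hd
    fin_cases i <;> simp only [Fin.zero_eta, Fin.mk_one] <;> nlinarith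
  intro i
  have h3 := abs_le.1 (key i)
  have h4 := hp i
  exact ⟨by linarith [h4.1], by linarith [h4.2]⟩

theorem cond_square_real_compl_innerSquare_le {d s : ℝ} (hs : 0 < s) (hd : 0 ≤ d)
    (hds : 2 * d ≤ s) :
    (cond (volume : Measure Plane) (square s)).real (innerSquare d s)ᶜ ≤ 4 * d / s := by
  have := isProbabilityMeasure_cond_square hs
  rw [probReal_compl_eq_one_sub (measurableSet_innerSquare d s),
    cond_square_real_eq (T := innerSquare d s) hs (sq_nonneg (s - d - d)) _
      (volume_plane_box d (s - d) (by linarith))]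
  · have : 1 - (s - d - d) ^ 2 / s ^ 2 = 4 * d / s - (2 * d / s) ^ 2 := by
      field_simp
      ring
    rw [this]
    linarith [sq_nonneg (2 * d / s)]
  · intro p hp i
    have h4 := hp i
    exact ⟨by linarith [h4.1], by linarith [h4.2]⟩

/-! ### The probability that a given vertex survives -/

section Survival

variable {n : ℕ} {s r R : ℝ}

theorem measurableSet_near (i a : Fin n) (r : ℝ) :
    MeasurableSet {x : Fin n → Plane | x a ∈ nearDisk r (x i)} :=
  (measurableSet_lt (f := fun _ : Fin n → Plane => (0 : ℝ)) (g := fun x => dist (x a) (x i))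
    (by fun_prop) (by fun_prop)).inter
  (measurableSet_le (f := fun x : Fin n → Plane => dist (x a) (x i)) (g := fun _ => r)
    (by fun_prop) (by fun_prop))

theorem measurableSet_opposite (i a b : Fin n) (R : ℝ) :
    MeasurableSet {x : Fin n → Plane | x b ∈ oppositeBox R (x i) (x a)} :=
  (Measurable.frame (measurable_pi_apply i) (measurable_pi_apply a) (measurable_pi_apply b))
    (measurableSet_Icc.prod measurableSet_Icc)

theorem measurableSet_gap (i a b j : Fin n) :
    MeasurableSet {x : Fin n → Plane | x j ∈ gap (x i) (x a) (x b)} :=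
  (measurableSet_lt (f := fun x : Fin n → Plane => dist (x j) (x i)) (g := fun _ => (1 : ℝ))
    (by fun_prop) (by fun_prop)).inter
  ((measurableSet_le (f := fun _ : Fin n → Plane => (1 : ℝ)) (g := fun x => dist (x j) (x a))
    (by fun_prop) (by fun_prop)).inter
  (measurableSet_le (f := fun _ : Fin n → Plane => (1 : ℝ)) (g := fun x => dist (x j) (x b))
    (by fun_prop) (by fun_prop)))

theorem measurableSet_inner (i : Fin n) (d s : ℝ) :
    MeasurableSet {x : Fin n → Plane | x i ∈ innerSquare d s} :=
  measurable_pi_apply i (measurableSet_innerSquare d s)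

theorem uniformPoints_real_border_le (hs : 0 < s) (hR : 0 ≤ R) (hRs : 4 * R ≤ s) (i : Fin n) :
    (uniformPoints n s).real {x | x i ∉ innerSquare (2 * R) s} ≤ 8 * R / s := by
  have := isProbabilityMeasure_cond_square hs
  have h := pi_real_inter_le (cond (volume : Measure Plane) (square s)) i
    (E := Set.univ) (F := {x : Fin n → Plane | x i ∉ innerSquare (2 * R) s}) MeasurableSet.univ
    (measurableSet_inner i (2 * R) s).compl (by simp) (c := 8 * R / s) (by positivity) (by
      intro x _
      simp only [Set.mem_ofPred_eq, Function.update_self]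
      refine (cond_square_real_compl_innerSquare_le hs (by positivity) (by linarith)).trans_eq ?_
      ring)
  simpa [uniformPoints] using h

theorem one_sub_near_nonneg (hs : 0 < s) (hr : 0 ≤ r) (hrR : r ≤ 2 * R) (hRs : 4 * R ≤ s) :
    0 ≤ 1 - Real.pi * r ^ 2 / s ^ 2 := by
  rw [sub_nonneg, div_le_one (by positivity)]
  have h1 : r ^ 2 ≤ (s / 2) ^ 2 := pow_le_pow_left₀ hr (by linarith) 2
  nlinarith [Real.pi_le_four, sq_nonneg r]

theorem one_sub_opposite_nonneg (hs : 0 < s) (hR0 : 0 ≤ R) (hR : R ≤ 1 / 10) (hRs : 4 * R ≤ s) :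
    0 ≤ 1 - R ^ 3 / s ^ 2 := by
  rw [sub_nonneg, div_le_one (by positivity)]
  have h1 : (4 * R) ^ 2 ≤ s ^ 2 := pow_le_pow_left₀ (by positivity) hRs 2
  nlinarith [sq_nonneg R]

theorem uniformPoints_real_near_le (hs : 0 < s) (hr : 0 ≤ r) {i a : Fin n} (hia : i ≠ a)
    {E : Set (Fin n → Plane)} (hE : MeasurableSet E)
    (hEinv : ∀ x y, Function.update x a y ∈ E ↔ x ∈ E) :
    (uniformPoints n s).real (E ∩ {x | x a ∈ nearDisk r (x i)}) ≤ Real.pi * r ^ 2 / s ^ 2 := by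
  have := isProbabilityMeasure_cond_square hs
  have hprob := isProbabilityMeasure_uniformPoints n hs
  refine (pi_real_inter_le (cond (volume : Measure Plane) (square s)) a hE
    (measurableSet_near i a r) hEinv (c := Real.pi * r ^ 2 / s ^ 2) (by positivity) ?_).trans
    (mul_le_of_le_one_right (by positivity) (measureReal_le_one (μ := uniformPoints n s)))
  intro x _
  simp only [Set.mem_ofPred_eq, Function.update_self, Function.update_of_ne hia]
  exact cond_square_real_le hs (by positivity) (volume_nearDisk r hr (x i)).le

theorem uniformPoints_real_no_near_le (hs : 0 < s) (hr : 0 ≤ r) (hrR : r ≤ 2 * R) (hRs : 4 * R ≤ s)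
    (i : Fin n) (A : Finset (Fin n)) (hiA : i ∉ A) :
    (uniformPoints n s).real ({x | x i ∈ innerSquare (2 * R) s} ∩
      {x | ∀ a ∈ A, x ∈ {x : Fin n → Plane | x a ∈ nearDisk r (x i)}ᶜ}) ≤
      (1 - Real.pi * r ^ 2 / s ^ 2) ^ A.card := by
  have := isProbabilityMeasure_cond_square hs
  have hprob := isProbabilityMeasure_uniformPoints n hs
  have hnn : 0 ≤ 1 - Real.pi * r ^ 2 / s ^ 2 := one_sub_near_nonneg hs hr hrR hRs
  refine (pi_real_inter_forall_le (cond (volume : Measure Plane) (square s)) A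
    (measurableSet_inner i (2 * R) s) (fun a _ => (measurableSet_near i a r).compl) ?_ ?_
    hnn ?_).trans
    (mul_le_of_le_one_right (pow_nonneg hnn _) (measureReal_le_one (μ := uniformPoints n s)))
  · intro a ha x y
    have hia : i ≠ a := fun h => hiA (h ▸ ha)
    simp only [Set.mem_ofPred_eq, Function.update_of_ne hia]
  · intro a ha a' ha' hne x y
    have hia : i ≠ a' := fun h => hiA (h ▸ ha')
    simp only [Set.mem_compl_iff, Set.mem_ofPred_eq, Function.update_of_ne hia,
      Function.update_of_ne hne]
  · intro a ha x hx
    have hia : i ≠ a := fun h => hiA (h ▸ ha)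
    have hset : {y | Function.update x a y ∈ {x : Fin n → Plane | x a ∈ nearDisk r (x i)}ᶜ} =
        (nearDisk r (x i))ᶜ := by
      ext y
      simp [Function.update_of_ne hia]
    have hmeas : MeasurableSet (nearDisk r (x i)) :=
      (measurableSet_lt (f := fun _ : Plane => (0 : ℝ)) (g := fun q => dist q (x i))
        (by fun_prop) (by fun_prop)).inter
      (measurableSet_le (f := fun q : Plane => dist q (x i)) (g := fun _ => r)
        (by fun_prop) (by fun_prop))
    rw [hset, probReal_compl_eq_one_sub hmeas, cond_square_real_eq hs (by positivity)
      (fun q hq => mem_square_of_mem_innerSquare hx (hq.2.trans hrR)) (volume_nearDisk r hr (x i))]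

theorem uniformPoints_real_no_opposite_le (hs : 0 < s) (hr : 0 ≤ r) (hrR : r ≤ R)
    (hR : R ≤ 1 / 10) (hRs : 4 * R ≤ s) {i a : Fin n} (hia : i ≠ a) (B : Finset (Fin n))
    (hiB : i ∉ B) (haB : a ∉ B) :
    (uniformPoints n s).real
      (({x | x i ∈ innerSquare (2 * R) s} ∩ {x | x a ∈ nearDisk r (x i)}) ∩
        {x | ∀ b ∈ B, x ∈ {x : Fin n → Plane | x b ∈ oppositeBox R (x i) (x a)}ᶜ}) ≤
      (1 - R ^ 3 / s ^ 2) ^ B.card * (Real.pi * r ^ 2 / s ^ 2) := by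
  have := isProbabilityMeasure_cond_square hs
  have hprob := isProbabilityMeasure_uniformPoints n hs
  have hR0 : 0 ≤ R := hr.trans hrR
  have hnn : 0 ≤ 1 - R ^ 3 / s ^ 2 := one_sub_opposite_nonneg hs hR0 hR hRs
  refine (pi_real_inter_forall_le (cond (volume : Measure Plane) (square s)) B
    ((measurableSet_inner i (2 * R) s).inter (measurableSet_near i a r))
    (fun b _ => (measurableSet_opposite i a b R).compl) ?_ ?_ hnn ?_).trans
    (mul_le_mul_of_nonneg_left (uniformPoints_real_near_le hs hr hia
      (measurableSet_inner i (2 * R) s) ?_) (pow_nonneg hnn _))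
  · intro b hb x y
    have hib : i ≠ b := fun h => hiB (h ▸ hb)
    have hab : a ≠ b := fun h => haB (h ▸ hb)
    simp only [Set.mem_inter_iff, Set.mem_ofPred_eq, Function.update_of_ne hib,
      Function.update_of_ne hab]
  · intro b hb b' hb' hne x y
    have hib : i ≠ b' := fun h => hiB (h ▸ hb')
    have hab : a ≠ b' := fun h => haB (h ▸ hb')
    simp only [Set.mem_compl_iff, Set.mem_ofPred_eq, Function.update_of_ne hib,
      Function.update_of_ne hab, Function.update_of_ne hne]
  · intro b hb x hx
    have hib : i ≠ b := fun h => hiB (h ▸ hb)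
    have hab : a ≠ b := fun h => haB (h ▸ hb)
    have hset : {y | Function.update x b y ∈
        {x : Fin n → Plane | x b ∈ oppositeBox R (x i) (x a)}ᶜ} = (oppositeBox R (x i) (x a))ᶜ := by
      ext y
      simp [Function.update_of_ne hib, Function.update_of_ne hab]
    have hmeas : MeasurableSet (oppositeBox R (x i) (x a)) :=
      (Measurable.frame measurable_const measurable_const measurable_id)
        (measurableSet_Icc.prod measurableSet_Icc)
    rw [hset, probReal_compl_eq_one_sub hmeas, cond_square_real_eq hs (by positivity)
      (fun q hq => mem_square_of_mem_innerSquare hx.1 (dist_lt_one_of_mem hrR hR hx.2 hq).1)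
      (volume_oppositeBox hR0 hx.2.1)]
  · intro x y
    simp only [Set.mem_ofPred_eq, Function.update_of_ne hia]

theorem uniformPoints_real_gap_le (hs : 0 < s) (hr : 0 ≤ r) (hrR : r ≤ R) (hR : R ≤ 1 / 10)
    {i a b j : Fin n} (hia : i ≠ a) (hib : i ≠ b) (hab : a ≠ b)
    (hji : i ≠ j) (hja : a ≠ j) (hjb : b ≠ j) :
    (uniformPoints n s).real
      ((({x | x a ∈ nearDisk r (x i)}) ∩ {x | x b ∈ oppositeBox R (x i) (x a)}) ∩
        {x | x j ∈ gap (x i) (x a) (x b)}) ≤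
      (144 * R ^ 2 * r / s ^ 2) * ((R ^ 3 / s ^ 2) * (Real.pi * r ^ 2 / s ^ 2)) := by
  have := isProbabilityMeasure_cond_square hs
  have hR0 : 0 ≤ R := hr.trans hrR
  have hnear := uniformPoints_real_near_le hs hr hia MeasurableSet.univ (by simp)
  rw [Set.univ_inter] at hnear
  refine (pi_real_inter_le (cond (volume : Measure Plane) (square s)) j
    ((measurableSet_near i a r).inter (measurableSet_opposite i a b R))
    (measurableSet_gap i a b j) ?_ (c := 144 * R ^ 2 * r / s ^ 2) (by positivity) ?_).trans
    (mul_le_mul_of_nonneg_left ((pi_real_inter_le (cond (volume : Measure Plane) (square s)) b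
      (measurableSet_near i a r) (measurableSet_opposite i a b R) ?_ (c := R ^ 3 / s ^ 2)
      (by positivity) ?_).trans (mul_le_mul_of_nonneg_left hnear (by positivity))) (by positivity))
  · intro x y
    simp only [Set.mem_inter_iff, Set.mem_ofPred_eq, Function.update_of_ne hji,
      Function.update_of_ne hja, Function.update_of_ne hjb]
  · intro x hx
    simp only [Set.mem_ofPred_eq, Function.update_of_ne hji, Function.update_of_ne hja,
      Function.update_of_ne hjb, Function.update_self]
    exact cond_square_real_le hs (by positivity) (volume_gap_le hrR hR hx.1 hx.2)
  · intro x y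
    simp only [Set.mem_ofPred_eq, Function.update_of_ne hib, Function.update_of_ne hab]
  · intro x hx
    simp only [Set.mem_ofPred_eq, Function.update_of_ne hib, Function.update_of_ne hab,
      Function.update_self]
    exact cond_square_real_le hs (by positivity) (volume_oppositeBox hR0 hx.1).le

/-- The first moment bound for survival. A vertex `i` that is not pruned lies close to the border,
or has no point of `A` in its near disk, or has such a point without a partner from `B` in the
opposite box, or has a pair of such partners whose gap contains another point. -/
theorem uniformPoints_real_not_excluded_le (hs : 0 < s) (hr : 0 ≤ r) (hrR : r ≤ R)
    (hR : R ≤ 1 / 10) (hRs : 4 * R ≤ s) (i : Fin n) (A B : Finset (Fin n))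
    (hA : ∀ a ∈ A, i < a) (hAB : ∀ a ∈ A, ∀ b ∈ B, a < b) (hB : ∀ b ∈ B, i < b) :
    (uniformPoints n s).real {x | ¬ Rule2Excludes (unitDiskGraph x) i} ≤
      8 * R / s + (1 - Real.pi * r ^ 2 / s ^ 2) ^ A.card
      + A.card * ((1 - R ^ 3 / s ^ 2) ^ B.card * (Real.pi * r ^ 2 / s ^ 2))
      + A.card * (B.card * (n * ((144 * R ^ 2 * r / s ^ 2) *
        ((R ^ 3 / s ^ 2) * (Real.pi * r ^ 2 / s ^ 2))))) := by
  have hprob := isProbabilityMeasure_uniformPoints n hs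
  have hR0 : 0 ≤ R := hr.trans hrR
  have hiA : i ∉ A := fun h => (hA i h).false
  have hiB : i ∉ B := fun h => (hB i h).false
  set E₀ : Set (Fin n → Plane) := {x | x i ∉ innerSquare (2 * R) s} with hE₀
  set E₁ : Set (Fin n → Plane) := {x | x i ∈ innerSquare (2 * R) s} ∩
      {x | ∀ a ∈ A, x ∈ {x : Fin n → Plane | x a ∈ nearDisk r (x i)}ᶜ} with hE₁
  set E₂ : Fin n → Set (Fin n → Plane) := fun a =>
    ({x | x i ∈ innerSquare (2 * R) s} ∩ {x | x a ∈ nearDisk r (x i)}) ∩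
      {x | ∀ b ∈ B, x ∈ {x : Fin n → Plane | x b ∈ oppositeBox R (x i) (x a)}ᶜ} with hE₂
  set E₃ : Fin n → Fin n → Fin n → Set (Fin n → Plane) := fun a b j =>
    {x | (i ≠ j ∧ a ≠ j ∧ b ≠ j) ∧ x ∈ ((({x | x a ∈ nearDisk r (x i)}) ∩
      {x | x b ∈ oppositeBox R (x i) (x a)}) ∩ {x | x j ∈ gap (x i) (x a) (x b)})} with hE₃
  have hsub : {x | ¬ Rule2Excludes (unitDiskGraph x) i} ⊆
      ((E₀ ∪ E₁) ∪ ⋃ a ∈ A, E₂ a) ∪ ⋃ a ∈ A, ⋃ b ∈ B, ⋃ j ∈ Finset.univ, E₃ a b j := by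
    intro x hx
    by_contra hcon
    simp only [Set.mem_union, Set.mem_iUnion, not_or, not_exists] at hcon
    obtain ⟨⟨⟨h0, h1⟩, h2⟩, h3⟩ := hcon
    have hin : x i ∈ innerSquare (2 * R) s := not_not.1 h0
    obtain ⟨a, ha, hna⟩ : ∃ a ∈ A, x a ∈ nearDisk r (x i) := by
      by_contra! h
      exact h1 ⟨hin, fun a ha => h a ha⟩
    obtain ⟨b, hb, hob⟩ : ∃ b ∈ B, x b ∈ oppositeBox R (x i) (x a) := by
      by_contra! h
      exact h2 a ha ⟨⟨hin, hna⟩, fun b hb => h b hb⟩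
    refine hx (rule2Excludes_of_gap_empty hrR hR (hA a ha) (hAB a ha b hb) hna hob ?_)
    intro j hji hja hjb hg
    exact h3 a ha b hb j (Finset.mem_univ j) ⟨⟨hji.symm, hja.symm, hjb.symm⟩, ⟨hna, hob⟩, hg⟩
  have b0 := uniformPoints_real_border_le hs hR0 hRs i
  have b1 := uniformPoints_real_no_near_le hs hr (by linarith) hRs i A hiA
  have b2 : (uniformPoints n s).real (⋃ a ∈ A, E₂ a) ≤
      A.card * ((1 - R ^ 3 / s ^ 2) ^ B.card * (Real.pi * r ^ 2 / s ^ 2)) := by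
    refine (measureReal_biUnion_finset_le A E₂).trans ?_
    rw [← nsmul_eq_mul]
    exact Finset.sum_le_card_nsmul A _ _ fun a ha => uniformPoints_real_no_opposite_le hs hr hrR
      hR hRs (hA a ha).ne B hiB fun h => (hAB a ha a h).false
  have b3 : (uniformPoints n s).real (⋃ a ∈ A, ⋃ b ∈ B, ⋃ j ∈ Finset.univ, E₃ a b j) ≤
      A.card * (B.card * (n * ((144 * R ^ 2 * r / s ^ 2) *
        ((R ^ 3 / s ^ 2) * (Real.pi * r ^ 2 / s ^ 2))))) := by
    refine (measureReal_biUnion_finset_le A _).trans ?_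
    rw [← nsmul_eq_mul]
    refine Finset.sum_le_card_nsmul A _ _ fun a ha => ?_
    refine (measureReal_biUnion_finset_le B _).trans ?_
    rw [← nsmul_eq_mul]
    refine Finset.sum_le_card_nsmul B _ _ fun b hb => ?_
    refine (measureReal_biUnion_finset_le Finset.univ _).trans ?_
    rw [← nsmul_eq_mul]
    refine (Finset.sum_le_card_nsmul Finset.univ _ _ fun j _ => ?_).trans_eq
      (by rw [Finset.card_fin])
    by_cases hj : i ≠ j ∧ a ≠ j ∧ b ≠ j
    · exact (measureReal_mono fun x hx => hx.2).trans (uniformPoints_real_gap_le hs hr hrR hR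
        (hA a ha).ne (hB b hb).ne (hAB a ha b hb).ne hj.1 hj.2.1 hj.2.2)
    · have : E₃ a b j = ∅ := Set.eq_empty_of_forall_notMem fun x hx => hj hx.1
      rw [this, measureReal_empty]
      positivity
  refine (measureReal_mono hsub).trans ((measureReal_union_le _ _).trans ?_)
  refine add_le_add ((measureReal_union_le _ _).trans ?_) b3
  refine add_le_add ((measureReal_union_le _ _).trans ?_) b2
  exact add_le_add b0 b1

end Survival

/-! ### Expected sizes -/

theorem measurable_of_unitDiskGraph {n : ℕ} {β : Type*} [MeasurableSpace β]
    (f : SimpleGraph (Fin n) → β) : Measurable fun x : Fin n → Plane => f (unitDiskGraph x) := by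
  have h1 : Measurable fun (x : Fin n → Plane) (p : Fin n × Fin n) =>
      (unitDiskGraph x).Adj p.1 p.2 := by
    refine measurable_pi_lambda _ fun p => ?_
    apply Measurable.and measurable_const
    exact (measurableSet_lt (f := fun x : Fin n → Plane => dist (x p.1) (x p.2))
      (g := fun _ => (1 : ℝ)) (by fun_prop) (by fun_prop)).mem
  have h2 : (fun x : Fin n → Plane => f (unitDiskGraph x)) =
      (fun g : Fin n × Fin n → Prop => f (SimpleGraph.fromRel fun i j => g (i, j))) ∘
        fun x p => (unitDiskGraph x).Adj p.1 p.2 := by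
    funext x
    simp only [Function.comp_apply]
    congr 1
    ext i j
    simp only [SimpleGraph.fromRel_adj, (unitDiskGraph x).adj_comm j i, or_self]
    exact ⟨fun h => ⟨h.ne, h⟩, fun h => h.2⟩
  rw [h2]
  exact (measurable_of_countable _).comp h1

theorem card_rule2Pruned_add_card_rule2Set {V : Type*} [Fintype V] [LinearOrder V]
    (G : SimpleGraph V) : (rule2Pruned G).card + (rule2Set G).card = Fintype.card V := by
  classical
  unfold rule2Pruned rule2Set
  rw [Finset.card_filter_add_card_filter_not, Finset.card_univ]

theorem integrable_of_unitDiskGraph (n : ℕ) {s : ℝ} (hs : 0 < s)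
    (f : SimpleGraph (Fin n) → Finset (Fin n)) :
    Integrable (fun x => ((f (unitDiskGraph x)).card : ℝ)) (uniformPoints n s) := by
  have := isProbabilityMeasure_uniformPoints n hs
  refine Integrable.of_bound
    (measurable_of_unitDiskGraph fun G => ((f G).card : ℝ)).aestronglyMeasurable n
    (Eventually.of_forall fun x => ?_)
  simpa using card_finset_fin_le (f (unitDiskGraph x))

theorem expectedPruned_add_expectedRule2Size (n : ℕ) {s : ℝ} (hs : 0 < s) :
    expectedPruned n s + expectedRule2Size n s = n := by
  have := isProbabilityMeasure_uniformPoints n hs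
  unfold expectedPruned expectedRule2Size
  rw [← integral_add (integrable_of_unitDiskGraph n hs rule2Pruned)
    (integrable_of_unitDiskGraph n hs rule2Set)]
  have : ∀ x : Fin n → Plane, ((rule2Pruned (unitDiskGraph x)).card : ℝ) +
      ((rule2Set (unitDiskGraph x)).card : ℝ) = n := by
    intro x
    exact_mod_cast (card_rule2Pruned_add_card_rule2Set (unitDiskGraph x)).trans (Fintype.card_fin n)
  simp [this]

theorem expectedRule2Size_eq_sum (n : ℕ) {s : ℝ} (hs : 0 < s) :
    expectedRule2Size n s =
      ∑ i : Fin n, (uniformPoints n s).real {x | ¬ Rule2Excludes (unitDiskGraph x) i} := by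
  classical
  have := isProbabilityMeasure_uniformPoints n hs
  have hmeas : ∀ i : Fin n, MeasurableSet
      {x : Fin n → Plane | ¬ Rule2Excludes (unitDiskGraph x) i} := fun i =>
    measurableSet_setOfPred.2 (measurable_of_unitDiskGraph fun G => ¬ Rule2Excludes G i)
  have hcard : ∀ x : Fin n → Plane, ((rule2Set (unitDiskGraph x)).card : ℝ) =
      ∑ i : Fin n, {x : Fin n → Plane | ¬ Rule2Excludes (unitDiskGraph x) i}.indicator
        (fun _ => (1 : ℝ)) x := by
    intro x
    unfold rule2Set
    rw [Finset.card_filter]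
    push_cast
    refine Finset.sum_congr rfl fun i _ => ?_
    by_cases h : Rule2Excludes (unitDiskGraph x) i <;> simp [h]
  unfold expectedRule2Size
  simp only [hcard]
  rw [integral_finsetSum _ fun i _ => (integrable_const (1 : ℝ)).indicator (hmeas i)]
  refine Finset.sum_congr rfl fun i _ => ?_
  rw [integral_indicator_const _ (hmeas i)]
  simp

/-- The last `2 * m` identifiers are counted in full; each earlier vertex has `m` candidates for
either partner. -/
theorem expectedRule2Size_le {n m : ℕ} {s r R : ℝ} (hm : 0 < m) (hs : 0 < s) (hr : 0 ≤ r)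
    (hrR : r ≤ R) (hR : R ≤ 1 / 10) (hRs : 4 * R ≤ s) :
    expectedRule2Size n s ≤ 2 * m + n * (8 * R / s + (1 - Real.pi * r ^ 2 / s ^ 2) ^ m
      + m * ((1 - R ^ 3 / s ^ 2) ^ m * (Real.pi * r ^ 2 / s ^ 2))
      + m * (m * (n * ((144 * R ^ 2 * r / s ^ 2) *
        ((R ^ 3 / s ^ 2) * (Real.pi * r ^ 2 / s ^ 2)))))) := by
  have hprob := isProbabilityMeasure_uniformPoints n hs
  have hR0 : 0 ≤ R := hr.trans hrR
  set K : ℝ := 8 * R / s + (1 - Real.pi * r ^ 2 / s ^ 2) ^ m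
      + m * ((1 - R ^ 3 / s ^ 2) ^ m * (Real.pi * r ^ 2 / s ^ 2))
      + m * (m * (n * ((144 * R ^ 2 * r / s ^ 2) *
        ((R ^ 3 / s ^ 2) * (Real.pi * r ^ 2 / s ^ 2))))) with hK
  have hlow : ∀ i : Fin n, i.val + 2 * m < n →
      (uniformPoints n s).real {x | ¬ Rule2Excludes (unitDiskGraph x) i} ≤ K := by
    intro i hi
    let u : Fin n := ⟨n - 2 * m, by omega⟩
    let v : Fin n := ⟨n - m, by omega⟩
    have hiu : i < u := by
      rw [Fin.lt_def]
      simp only [u]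
      omega
    have huv : u < v := by
      rw [Fin.lt_def]
      simp only [u, v]
      omega
    have h := uniformPoints_real_not_excluded_le hs hr hrR hR hRs i (Finset.Ico u v)
      (Finset.Ici v) (fun a ha => hiu.trans_le (Finset.mem_Ico.1 ha).1)
      (fun a ha b hb => (Finset.mem_Ico.1 ha).2.trans_le (Finset.mem_Ici.1 hb))
      (fun b hb => (hiu.trans huv).trans_le (Finset.mem_Ici.1 hb))
    have c1 : (Finset.Ico u v).card = m := by
      rw [Fin.card_Ico]
      simp only [u, v]
      omega
    have c2 : (Finset.Ici v).card = m := by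
      rw [Fin.card_Ici]
      simp only [v]
      omega
    rwa [c1, c2] at h
  have hK0 : 0 ≤ K := by
    have h1 : 0 ≤ 1 - Real.pi * r ^ 2 / s ^ 2 := one_sub_near_nonneg hs hr (by linarith) hRs
    have h2 : 0 ≤ 1 - R ^ 3 / s ^ 2 := one_sub_opposite_nonneg hs hR0 hR hRs
    rw [hK]
    positivity
  have hcard : (Finset.univ.filter fun i : Fin n => ¬ i.val + 2 * m < n).card ≤ 2 * m := by
    refine (Finset.card_le_card_of_injOn (t := Finset.Ico (n - 2 * m) n) Fin.val ?_
      Fin.val_injective.injOn).trans ?_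
    · intro i hi
      simp only [Finset.coe_filter, Finset.mem_univ, true_and, Set.mem_ofPred_eq] at hi
      simp only [Finset.coe_Ico, Set.mem_Ico]
      omega
    · rw [Nat.card_Ico]
      omega
  rw [expectedRule2Size_eq_sum n hs]
  calc _ ≤ ∑ i : Fin n, ((if ¬ i.val + 2 * m < n then (1 : ℝ) else 0) + K) := by
        refine Finset.sum_le_sum fun i _ => ?_
        by_cases hi : i.val + 2 * m < n
        · simpa [hi] using hlow i hi
        · rw [if_pos hi]
          linarith [measureReal_le_one (μ := uniformPoints n s)
            (s := {x | ¬ Rule2Excludes (unitDiskGraph x) i})]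
    _ = ((Finset.univ.filter fun i : Fin n => ¬ i.val + 2 * m < n).card : ℝ) + n * K := by
        rw [Finset.sum_add_distrib, Finset.sum_boole, Finset.sum_const, Finset.card_fin,
          nsmul_eq_mul]
    _ ≤ 2 * m + n * K := by
        gcongr
        exact_mod_cast hcard

/-! ### Choice of the radii and asymptotics -/

/-- The quantitative form of the bound: with density `a / s ^ 2 = t ^ 60` of candidate partners
and `n ≤ t * a`, the Rule 2 dominating set has expected size at most a constant multiple of `a`. -/
theorem expectedRule2Size_le_of_density {n : ℕ} {a s t : ℝ} (ht : 10 ≤ t) (hs : 1 ≤ s)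
    (ha : a = s ^ 2 * t ^ 60) (hn : n ≤ t * a) : expectedRule2Size n s ≤ 2400 * a := by
  have hs0 : 0 < s := by linarith
  have ht0 : 0 < t := by linarith
  have ha1 : 1 ≤ a := by
    rw [ha]
    exact one_le_mul_of_one_le_of_one_le (one_le_pow₀ hs) (one_le_pow₀ (by linarith))
  have ha0 : 0 < a := by linarith
  set m : ℕ := ⌈a⌉₊ with hm
  have hm1 : a ≤ m := Nat.le_ceil a
  have hm2 : (m : ℝ) ≤ 2 * a := by linarith [Nat.ceil_lt_add_one ha0.le]
  have hm0 : 0 < m := Nat.ceil_pos.2 ha0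
  -- `r` is slightly larger than `ξ ^ (-1 / 2)` and `R` than `ξ ^ (-1 / 3)`, where `ξ = t ^ 60`, so
  -- that partners abound; the expected number of triples is of order `t ^ (-1)` nevertheless.
  set r : ℝ := (t ^ 29)⁻¹ with hr
  set R : ℝ := (t ^ 19)⁻¹ with hR
  have hr0 : 0 < r := by positivity
  have hR0 : 0 < R := by positivity
  have hrR : r ≤ R := inv_anti₀ (by positivity) (pow_le_pow_right₀ (by linarith) (by norm_num))
  have hRt : R ≤ 1 / t := by
    rw [one_div]
    exact inv_anti₀ ht0 (le_self_pow₀ (by linarith) (by norm_num))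
  have ht10 : 1 / t ≤ 1 / 10 := one_div_le_one_div_of_le (by norm_num) ht
  have hnt : (n : ℝ) / t ≤ a := by
    rw [div_le_iff₀ ht0]
    linarith
  have h := expectedRule2Size_le (n := n) hm0 hs0 hr0.le hrR (hRt.trans ht10) (by linarith)
  have hpow : ∀ x : ℝ, 0 ≤ 1 - x → (1 - x) ^ m ≤ Real.exp (-(m * x)) := by
    intro x hx
    calc (1 - x) ^ m ≤ Real.exp (-x) ^ m := pow_le_pow_left₀ hx (Real.one_sub_le_exp_neg x) m
      _ = Real.exp (-(m * x)) := by
        rw [← Real.exp_nat_mul]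
        ring_nf
  have hexp : ∀ x : ℝ, 0 < x → Real.exp (-x) ≤ 1 / x := by
    intro x hx
    rw [Real.exp_neg, ← one_div]
    exact one_div_le_one_div_of_le hx (by linarith [Real.add_one_le_exp x])
  have e0 : 8 * R / s ≤ 8 * (1 / t) := by
    calc 8 * R / s ≤ 8 * R := div_le_self (by positivity) hs
      _ ≤ 8 * (1 / t) := by linarith
  have e1 : (1 - Real.pi * r ^ 2 / s ^ 2) ^ m ≤ 1 / t := by
    refine (hpow _ (one_sub_near_nonneg (R := R) hs0 hr0.le (by linarith) (by linarith))).trans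
      (le_trans (Real.exp_le_exp.2 (neg_le_neg ?_)) (hexp t ht0))
    calc t ≤ Real.pi * t ^ 2 := by nlinarith [Real.pi_gt_three]
      _ = a * (Real.pi * r ^ 2 / s ^ 2) := by
        rw [ha, hr]
        field_simp
      _ ≤ m * (Real.pi * r ^ 2 / s ^ 2) := by gcongr
  have e2 : m * ((1 - R ^ 3 / s ^ 2) ^ m * (Real.pi * r ^ 2 / s ^ 2)) ≤ 8 * (1 / t) := by
    have hopp : (1 - R ^ 3 / s ^ 2) ^ m ≤ 1 / t ^ 3 := by
      refine (hpow _ (one_sub_opposite_nonneg hs0 hR0.le (by linarith) (by linarith))).trans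
        (le_trans (Real.exp_le_exp.2 (neg_le_neg ?_)) (hexp (t ^ 3) (by positivity)))
      calc t ^ 3 = a * (R ^ 3 / s ^ 2) := by
            rw [ha, hR]
            field_simp
        _ ≤ m * (R ^ 3 / s ^ 2) := by gcongr
    calc m * ((1 - R ^ 3 / s ^ 2) ^ m * (Real.pi * r ^ 2 / s ^ 2))
        ≤ (2 * a) * (1 / t ^ 3 * (4 * r ^ 2 / s ^ 2)) := by
          have hnn := one_sub_opposite_nonneg hs0 hR0.le (hRt.trans ht10) (by linarith)
          have hpi := Real.pi_le_four
          gcongr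
      _ = 8 * (1 / t) := by
          rw [ha, hr]
          field_simp
          norm_num
  have e3 : m * (m * (n * ((144 * R ^ 2 * r / s ^ 2) *
        ((R ^ 3 / s ^ 2) * (Real.pi * r ^ 2 / s ^ 2))))) ≤ 2304 * (1 / t) := by
    calc _ ≤ (2 * a) * ((2 * a) * ((t * a) * ((144 * R ^ 2 * r / s ^ 2) *
        ((R ^ 3 / s ^ 2) * (4 * r ^ 2 / s ^ 2))))) := by
          gcongr
          exact Real.pi_le_four
      _ = 2304 * (1 / t) := by
          rw [ha, hr, hR]
          field_simp
          norm_num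
  refine h.trans ?_
  calc _ ≤ 2 * (2 * a) + n * (8 * (1 / t) + 1 / t + 8 * (1 / t) + 2304 * (1 / t)) := by
        gcongr
    _ = 4 * a + 2321 * (n / t) := by ring
    _ ≤ 2400 * a := by linarith

theorem eventually_log_rpow_le_rpow (p : ℝ) {q c : ℝ} (hq : 0 < q) (hc : 0 < c) :
    ∀ᶠ x : ℝ in atTop, Real.log x ^ p ≤ c * x ^ q := by
  filter_upwards [(isLittleO_log_rpow_rpow_atTop p hq).bound hc, eventually_ge_atTop 1]
    with x hx hx1
  have h1 : 0 ≤ Real.log x := Real.log_nonneg hx1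
  rwa [Real.norm_of_nonneg (Real.rpow_nonneg h1 p),
    Real.norm_of_nonneg (Real.rpow_nonneg (by linarith) q)] at hx

theorem tendsto_log_natCast : Tendsto (fun n : ℕ => Real.log n) atTop atTop :=
  Real.tendsto_log_atTop.comp tendsto_natCast_atTop_atTop

theorem eventually_expectedRule2Size_le {ℓ α : ℕ → ℝ}
    (hℓ : ∀ n : ℕ, 1 < n → Real.log n ≤ ℓ n)
    (hξ : Tendsto (fun n : ℕ => α n / ℓ n ^ 2) atTop atTop)
    (hα : ∀ᶠ n : ℕ in atTop,
      16 * (n : ℝ) / Real.log (α n / ℓ n ^ 2) ^ (3 / 2 : ℝ) < α n) :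
    ∀ᶠ n : ℕ in atTop, 1 ≤ ℓ n ∧ 0 ≤ α n ∧ expectedRule2Size n (ℓ n) ≤ 2400 * α n := by
  filter_upwards [hα, hξ.eventually_ge_atTop (10 ^ 60),
    hξ.eventually (eventually_log_rpow_le_rpow (3 / 2) (q := 1 / 60) (c := 16) (by norm_num)
      (by norm_num)),
    tendsto_log_natCast.eventually_ge_atTop 1, eventually_gt_atTop 1] with n h1 h2 h3 h4 h5
  have hs : 1 ≤ ℓ n := h4.trans (hℓ n h5)
  have hs2 : 0 < ℓ n ^ 2 := by positivity
  set ξ := α n / ℓ n ^ 2 with hξdef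
  have hξ0 : 0 < ξ := lt_of_lt_of_le (by norm_num) h2
  have hαeq : α n = ℓ n ^ 2 * ξ := by
    rw [hξdef]
    field_simp
  have hα0 : 0 < α n := by
    rw [hαeq]
    positivity
  set t : ℝ := ξ ^ (1 / 60 : ℝ) with ht
  have ht60 : t ^ 60 = ξ := by
    rw [ht, ← Real.rpow_natCast, ← Real.rpow_mul hξ0.le]
    norm_num
  have ht0 : 0 ≤ t := Real.rpow_nonneg hξ0.le _
  have ht10 : 10 ≤ t := by
    refine le_of_pow_le_pow_left₀ (n := 60) (by norm_num) ht0 ?_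
    rwa [ht60]
  have hlog : 0 < Real.log ξ := Real.log_pos (lt_of_lt_of_le (by norm_num) h2)
  have hL : 0 < Real.log ξ ^ (3 / 2 : ℝ) := Real.rpow_pos_of_pos hlog _
  refine ⟨hs, hα0.le, expectedRule2Size_le_of_density ht10 hs (by rw [hαeq, ht60]) ?_⟩
  rw [div_lt_iff₀ hL] at h1
  have := mul_le_mul_of_nonneg_left h3 hα0.le
  linarith

theorem isBigO_expectedRule2Size {ℓ α : ℕ → ℝ}
    (hℓ : ∀ n : ℕ, 1 < n → Real.log n ≤ ℓ n)
    (hξ : Tendsto (fun n : ℕ => α n / ℓ n ^ 2) atTop atTop)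
    (hα : ∀ᶠ n : ℕ in atTop,
      16 * (n : ℝ) / Real.log (α n / ℓ n ^ 2) ^ (3 / 2 : ℝ) < α n) :
    (fun n : ℕ => expectedRule2Size n (ℓ n)) =O[atTop] α := by
  refine IsBigO.of_bound 2400 ?_
  filter_upwards [eventually_expectedRule2Size_le hℓ hξ hα] with n hn
  have h0 : 0 ≤ expectedRule2Size n (ℓ n) := integral_nonneg fun x => Nat.cast_nonneg _
  rw [Real.norm_of_nonneg h0,
    Real.norm_of_nonneg hn.2.1]
  exact hn.2.2

/-- The sequence `100 * n / (log log n) ^ (3 / 2)` gives `ξ ≥ √(log n)`, hence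
`log ξ ≥ log log n / 2`, and so it meets the requirements on `α`. -/
theorem eventually_sqrt_log_le_density {ℓ : ℕ → ℝ} {c : ℝ} (hc : 0 < c)
    (hℓ : ∀ n : ℕ, 1 < n →
      Real.log n ≤ ℓ n ∧ ℓ n ≤ c * Real.sqrt ((n : ℝ) / Real.log n)) :
    ∀ᶠ n : ℕ in atTop, Real.log n ^ (1 / 2 : ℝ) ≤
      100 * ((n : ℝ) / Real.log (Real.log n) ^ (3 / 2 : ℝ)) / ℓ n ^ 2 := by
  filter_upwards [tendsto_log_natCast.eventually (eventually_log_rpow_le_rpow (3 / 2)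
      (q := 1 / 2) (c := 100 / c ^ 2) (by norm_num) (by positivity)),
    tendsto_log_natCast.eventually_gt_atTop 1, eventually_gt_atTop 1] with n h1 h2 h3
  obtain ⟨h4, h5⟩ := hℓ n h3
  have hn : (0 : ℝ) < n := by exact_mod_cast (by omega : 0 < n)
  have hL : 0 < Real.log (Real.log n) ^ (3 / 2 : ℝ) := Real.rpow_pos_of_pos (Real.log_pos h2) _
  have hl : 0 < ℓ n := by linarith
  have h6 : ℓ n ^ 2 ≤ c ^ 2 * (n / Real.log n) := by
    calc ℓ n ^ 2 ≤ (c * Real.sqrt ((n : ℝ) / Real.log n)) ^ 2 := by gcongr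
      _ = c ^ 2 * (n / Real.log n) := by rw [mul_pow, Real.sq_sqrt (by positivity)]
  have hhalf : Real.log n ^ (1 / 2 : ℝ) * Real.log n ^ (1 / 2 : ℝ) = Real.log n := by
    rw [← Real.rpow_add (by linarith)]
    norm_num
  have hh0 : 0 < Real.log n ^ (1 / 2 : ℝ) := Real.rpow_pos_of_pos (by linarith) _
  generalize Real.log n ^ (1 / 2 : ℝ) = y at *
  generalize Real.log (Real.log n) ^ (3 / 2 : ℝ) = L at *
  rw [← hhalf] at h6
  rw [le_div_iff₀ (by positivity), mul_div_assoc', le_div_iff₀ hL]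
  calc y * ℓ n ^ 2 * L ≤ y * (c ^ 2 * ((n : ℝ) / (y * y))) * (100 / c ^ 2 * y) := by gcongr
    _ = 100 * (n : ℝ) := by field_simp

theorem theorem5 (ℓ : ℕ → ℝ) (c : ℝ) (hc : 0 < c)
    (hℓ : ∀ n : ℕ, 1 < n →
      Real.log n ≤ ℓ n ∧ ℓ n ≤ c * Real.sqrt ((n : ℝ) / Real.log n)) :
    (∀ α : ℕ → ℝ,
      α =o[atTop] (fun n : ℕ => (n : ℝ)) →
      Tendsto (fun n : ℕ => α n / ℓ n ^ 2) atTop atTop →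
      (∀ᶠ n : ℕ in atTop,
        16 * (n : ℝ) / Real.log (α n / ℓ n ^ 2) ^ (3 / 2 : ℝ) < α n) →
      (∃ C : ℝ, 0 < C ∧ ∀ᶠ n : ℕ in atTop,
        (n : ℝ) - C * α n ≤ expectedPruned n (ℓ n)) ∧
      (fun n : ℕ => expectedRule2Size n (ℓ n)) =O[atTop] α) ∧
    (fun n : ℕ => expectedRule2Size n (ℓ n)) =O[atTop]
      (fun n : ℕ => (n : ℝ) / Real.log (Real.log n) ^ (3 / 2 : ℝ)) := by
  have hℓ' : ∀ n : ℕ, 1 < n → Real.log n ≤ ℓ n := fun n hn => (hℓ n hn).1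
  refine ⟨fun α _ hξ hα => ⟨⟨2400, by norm_num, ?_⟩, isBigO_expectedRule2Size hℓ' hξ hα⟩, ?_⟩
  · filter_upwards [eventually_expectedRule2Size_le hℓ' hξ hα] with n hn
    have := expectedPruned_add_expectedRule2Size n (s := ℓ n) (by linarith [hn.1])
    linarith [hn.2.2]
  · have hdens := eventually_sqrt_log_le_density hc hℓ
    refine (isBigO_expectedRule2Size hℓ'
      (α := fun n => 100 * ((n : ℝ) / Real.log (Real.log n) ^ (3 / 2 : ℝ))) ?_ ?_).trans
      (isBigO_const_mul_self 100 _ _)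
    · exact tendsto_atTop_mono' atTop hdens
        ((tendsto_rpow_atTop (by norm_num)).comp tendsto_log_natCast)
    · filter_upwards [hdens, tendsto_log_natCast.eventually_gt_atTop 1, eventually_gt_atTop 1]
        with n h1 h2 h3
      have hn : (0 : ℝ) < n := by exact_mod_cast (by omega : 0 < n)
      have hLL : 0 < Real.log (Real.log n) := Real.log_pos h2
      have hlog := Real.log_le_log (Real.rpow_pos_of_pos (by linarith) _) h1
      rw [Real.log_rpow (by linarith)] at hlog
      have hpow := Real.rpow_le_rpow (by positivity) hlog (show (0 : ℝ) ≤ 3 / 2 by norm_num)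
      rw [Real.mul_rpow (by norm_num) hLL.le] at hpow
      have hquarter : (1 / 4 : ℝ) ≤ (1 / 2 : ℝ) ^ (3 / 2 : ℝ) := by
        calc (1 / 4 : ℝ) = (1 / 2 : ℝ) ^ (2 : ℝ) := by norm_num
          _ ≤ (1 / 2 : ℝ) ^ (3 / 2 : ℝ) :=
            Real.rpow_le_rpow_of_exponent_ge (by norm_num) (by norm_num) (by norm_num)
      have hL : 0 < Real.log (Real.log n) ^ (3 / 2 : ℝ) := Real.rpow_pos_of_pos hLL _
      calc _ ≤ 16 * (n : ℝ) / (1 / 4 * Real.log (Real.log n) ^ (3 / 2 : ℝ)) := by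
            apply div_le_div_of_nonneg_left (by positivity) (by positivity)
            exact (mul_le_mul_of_nonneg_right hquarter hL.le).trans hpow
        _ = 64 * (n / Real.log (Real.log n) ^ (3 / 2 : ℝ)) := by
            field_simp
            norm_num
        _ < 100 * (n / Real.log (Real.log n) ^ (3 / 2 : ℝ)) := by
            have : 0 < n / Real.log (Real.log n) ^ (3 / 2 : ℝ) := by positivity
            linarith
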